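/- Let $m,n$ be non-negative integers and let $E$ be a (complex) linear subspace of the space $\mathbb{C}^{n\times m}$ of complex $n\times m$ matrices. For $A\in\mathbb{C}^{m\times n}$ define the structured singular value $\mu_E(A)\in[0,\infty]$ by $$\frac{1}{\mu_E(A)}=\inf\{\|X\| : X\in E,\ \det(1-AX)=0\},$$ where $\|X\|$ is the operator norm of $X$ with respect to the Euclidean norms and $\mu_E(A)=0$ if there is no such $X$. Let $\mathbb{D}$ be the open unit disc in $\mathbb{C}$. The Nevanlinna class $N$ consists of the holomorphic functions $f$ on $\mathbb{D}$ with $$\sup_{0<r<1}\frac{1}{2\pi}\int_0^{2\pi}\log^+|f(re^{i\theta})|\,d\theta<\infty,$$ and a matrix-valued function on $\mathbb{D}$ is said to belong to $N$ if each of its entries does. Let $\lambda_0\in\mathbb{D}\setminus\{0\}$ and $W\in\mathbb{C}^{m\times n}$. There exists a holomorphic function $F:\mathbb{D}\to\mathbb{C}^{m\times n}$ in $N$ such that 1. $F(0)=0$ and $F(\lambda_0)=W$, and 2. $\mu_E(F(\lambda))<1$ for all $\lambda\in\mathbb{D}$ if and only if $\mu_E(W)\le|\lambda_0|$. -/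

import Mathlib

open scoped Matrix.Norms.L2Operator in
/-- The structured singular value `μ_E(A) ∈ [0, ∞]` of an `m × n` complex matrix `A`
corresponding to the linear subspace `E` of the `n × m` complex matrices:
`1 / μ_E(A) = inf {‖X‖ : X ∈ E, det (1 - A X) = 0}`, where `‖X‖` is the operator norm of `X`
between Euclidean spaces. The infimum is taken in `[0, ∞]`, so that `μ_E(A) = 0` when there is
no such `X`. -/
noncomputable def structuredSingularValue {m n : ℕ}
    (E : Submodule ℂ (Matrix (Fin n) (Fin m) ℂ)) (A : Matrix (Fin m) (Fin n) ℂ) : ENNReal :=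
  (⨅ (X : Matrix (Fin n) (Fin m) ℂ) (_ : X ∈ E ∧ (1 - A * X).det = 0), ‖X‖ₑ)⁻¹

/-- The Nevanlinna class of the open unit disc: the holomorphic functions `f` on the disc for
which the circular means `(2π)⁻¹ ∫ log⁺ |f (r e^{iθ})| dθ` are bounded for `0 < r < 1`. -/
def IsNevanlinna (f : ℂ → ℂ) : Prop :=
  DifferentiableOn ℂ f (Metric.ball 0 1) ∧
    ∃ C : ℝ, ∀ r : ℝ, 0 < r → r < 1 →
      Real.circleAverage (fun z : ℂ => Real.posLog ‖f z‖) 0 r ≤ C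

/-- A matrix-valued function on the open unit disc is holomorphic and belongs to the Nevanlinna
class when each of its entries does. -/
def IsMatrixNevanlinna {m n : ℕ} (F : ℂ → Matrix (Fin m) (Fin n) ℂ) : Prop :=
  ∀ i j, IsNevanlinna (fun z => F z i j)

/-!
Since `E` is closed under scalars, `μ_E(A) ≤ c` holds exactly when `c * ‖X‖` bounds the spectral
radius of `A * X` for every `X ∈ E`. So necessity is a Schwarz lemma for the spectral radius,
applied to the holomorphic functions `z ↦ F z * X`. Writing `F z * X = z • G z`, that lemma is the
maximum principle for the spectral radius of `G`: by Gelfand's formula and compactness of the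
boundary, a strict bound `c` on the boundary gives one exponent `n` with `‖G z ^ n‖ < c ^ n` there,
and the maximum modulus principle carries this inequality inside. For sufficiency, take the linear
function `z ↦ z • (lam₀⁻¹ • W)`.
-/

section SpectralRadius

open Filter Metric Set
open scoped ENNReal NNReal Topology

theorem spectralRadius_smul {𝕜 A : Type*} [NormedField 𝕜] [Ring A] [Algebra 𝕜 A] (k : 𝕜) (a : A) :
    spectralRadius 𝕜 (k • a) = ‖k‖ₑ * spectralRadius 𝕜 a := by
  rcases eq_or_ne k 0 with rfl | hk
  · simp
  have hspec : spectrum 𝕜 (k • a) = (k * ·) '' spectrum 𝕜 a :=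
    spectrum.unit_smul_eq_smul a (Units.mk0 k hk)
  simp only [spectralRadius, hspec, iSup_image, ENNReal.mul_iSup, ← enorm_eq_nnnorm, enorm_mul]

theorem nnnorm_pow_mul_lt_pow_mul {A : Type*} [SeminormedRing A] {a : A} {c : ℝ≥0} {n k : ℕ}
    (hk : k ≠ 0) (h : ‖a ^ n‖₊ < c ^ n) : ‖a ^ (n * k)‖₊ < c ^ (n * k) := by
  rw [pow_mul, pow_mul]
  exact (nnnorm_pow_le' _ (Nat.pos_of_ne_zero hk)).trans_lt (pow_lt_pow_left₀ h zero_le hk)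

variable {A : Type*} [NormedRing A] [NormedAlgebra ℂ A] [CompleteSpace A]

theorem spectralRadius_le_of_nnnorm_pow_le {a : A} {c : ℝ≥0} {n : ℕ} (hn : n ≠ 0)
    (h : ‖a ^ n‖₊ ≤ c ^ n) : spectralRadius ℂ a ≤ c := by
  have hlim := (spectrum.pow_nnnorm_pow_one_div_tendsto_nhds_spectralRadius a).comp
    (tendsto_id.const_mul_atTop' (Nat.pos_of_ne_zero hn))
  refine le_of_tendsto hlim ((eventually_ne_atTop 0).mono fun k hk => ?_)
  have hpow : ‖a ^ (n * k)‖₊ ≤ c ^ (n * k) := by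
    rw [pow_mul, pow_mul]
    exact (nnnorm_pow_le' _ (Nat.pos_of_ne_zero hk)).trans (by gcongr)
  have hnk : ((n * k : ℕ) : ℝ) ≠ 0 := by exact_mod_cast mul_ne_zero hn hk
  calc (‖a ^ (n * k)‖₊ : ℝ≥0∞) ^ (1 / (n * k : ℕ) : ℝ)
      ≤ ((c : ℝ≥0∞) ^ (n * k)) ^ (1 / (n * k : ℕ) : ℝ) := by gcongr; exact_mod_cast hpow
    _ = c := by rw [← ENNReal.rpow_natCast, ← ENNReal.rpow_mul, mul_one_div_cancel hnk,
        ENNReal.rpow_one]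

theorem exists_nnnorm_pow_lt_of_spectralRadius_lt {a : A} {c : ℝ≥0}
    (h : spectralRadius ℂ a < c) : ∃ n ≠ 0, ‖a ^ n‖₊ < c ^ n := by
  have hlim := spectrum.pow_nnnorm_pow_one_div_tendsto_nhds_spectralRadius a
  obtain ⟨n, hlt, hn⟩ := ((hlim.eventually_lt_const h).and (eventually_ne_atTop 0)).exists
  refine ⟨n, hn, ?_⟩
  have hpos : 0 < (n : ℝ) := by exact_mod_cast Nat.pos_of_ne_zero hn
  rw [one_div, ENNReal.rpow_inv_lt_iff hpos, ENNReal.rpow_natCast] at hlt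
  exact_mod_cast hlt

theorem exists_forall_nnnorm_pow_lt_of_isCompact {X : Type*} [TopologicalSpace X] {K : Set X}
    (hK : IsCompact K) {f : X → A} (hf : ContinuousOn f K) {c : ℝ≥0}
    (h : ∀ x ∈ K, spectralRadius ℂ (f x) < c) : ∃ n ≠ 0, ∀ x ∈ K, ‖f x ^ n‖₊ < c ^ n := by
  refine hK.induction_on (p := fun s => ∃ n ≠ 0, ∀ x ∈ s, ‖f x ^ n‖₊ < c ^ n)
    ⟨1, one_ne_zero, by simp⟩ (fun s t hst ⟨n, hn, ht⟩ => ⟨n, hn, fun x hx => ht x (hst hx)⟩) ?_ ?_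
  · rintro s t ⟨n, hn, hs⟩ ⟨k, hk, ht⟩
    refine ⟨n * k, mul_ne_zero hn hk, fun x hx => ?_⟩
    rcases hx with hx | hx
    · exact nnnorm_pow_mul_lt_pow_mul hk (hs x hx)
    · rw [mul_comm]
      exact nnnorm_pow_mul_lt_pow_mul hn (ht x hx)
  · intro x hx
    obtain ⟨n, hn, hlt⟩ := exists_nnnorm_pow_lt_of_spectralRadius_lt (h x hx)
    exact ⟨_, ((hf x hx).pow n).nnnorm.eventually_lt_const hlt, n, hn, fun y hy => hy⟩

theorem spectralRadius_le_of_forall_mem_frontier_le {V : Type*}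
    [NormedAddCommGroup V] [NormedSpace ℂ V] [Nontrivial V] [ProperSpace V] {f : V → A} {U : Set V}
    (hU : Bornology.IsBounded U) (hd : DiffContOnCl ℂ f U) {C : ℝ≥0∞}
    (hC : ∀ z ∈ frontier U, spectralRadius ℂ (f z) ≤ C) {z : V} (hz : z ∈ closure U) :
    spectralRadius ℂ (f z) ≤ C := by
  refine le_of_forall_gt_imp_ge_of_dense fun C' hC' => ?_
  obtain ⟨c, hc, hcC'⟩ := ENNReal.lt_iff_exists_nnreal_btwn.1 hC'
  have hK : IsCompact (frontier U) := isCompact_of_isClosed_isBounded isClosed_frontier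
    (hU.closure.subset frontier_subset_closure)
  obtain ⟨n, hn, hlt⟩ := exists_forall_nnnorm_pow_lt_of_isCompact hK
    (hd.continuousOn.mono frontier_subset_closure) fun w hw => (hC w hw).trans_lt hc
  have hpow : DiffContOnCl ℂ (fun w => f w ^ n) U :=
    ⟨hd.differentiableOn.pow n, hd.continuousOn.pow n⟩
  have hle : ‖f z ^ n‖ ≤ (c : ℝ) ^ n :=
    Complex.norm_le_of_forall_mem_frontier_norm_le hU hpow (fun w hw => (hlt w hw).le) hz
  exact (spectralRadius_le_of_nnnorm_pow_le hn hle).trans hcC'.le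

variable {f : ℂ → A} {c z : ℂ} {R : ℝ} {C : ℝ≥0∞}

theorem spectralRadius_dslope_le_div_of_forall_mem_ball (hd : DifferentiableOn ℂ f (ball c R))
    (hf : f c = 0) (hC : ∀ w ∈ ball c R, spectralRadius ℂ (f w) ≤ C) (hz : z ∈ ball c R) :
    spectralRadius ℂ (dslope f c z) ≤ C / ENNReal.ofReal R := by
  have hR : 0 < R := pos_of_mem_ball hz
  have hslope : DifferentiableOn ℂ (dslope f c) (ball c R) :=
    (Complex.differentiableOn_dslope (ball_mem_nhds c hR)).2 hd
  have hlim : Tendsto (fun ρ => C / ENNReal.ofReal ρ) (𝓝[<] R) (𝓝 (C / ENNReal.ofReal R)) :=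
    ENNReal.Tendsto.const_div (ENNReal.continuous_ofReal.continuousWithinAt.tendsto)
      (Or.inl ENNReal.ofReal_ne_top)
  refine ge_of_tendsto hlim (mem_of_superset (Ioo_mem_nhdsLT (mem_ball.1 hz)) fun ρ hρ => ?_)
  have hρ0 : 0 < ρ := dist_nonneg.trans_lt hρ.1
  have hsub : closure (ball c ρ) ⊆ ball c R :=
    closure_ball_subset_closedBall.trans (closedBall_subset_ball hρ.2)
  refine spectralRadius_le_of_forall_mem_frontier_le isBounded_ball
    (hslope.mono hsub).diffContOnCl (fun w hw => ?_) (subset_closure hρ.1)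
  rw [frontier_ball c hρ0.ne', mem_sphere_iff_norm] at hw
  have hwc : w - c ≠ 0 := norm_pos_iff.1 (hw ▸ hρ0)
  have hwR : w ∈ ball c R := mem_ball_iff_norm.2 (hw.trans_lt hρ.2)
  calc spectralRadius ℂ (dslope f c w)
      = ‖w - c‖ₑ⁻¹ * spectralRadius ℂ (f w) := by
        rw [dslope_of_ne _ (sub_ne_zero.1 hwc), slope, hf, vsub_eq_sub, sub_zero,
          spectralRadius_smul, enorm_inv hwc]
    _ ≤ ‖w - c‖ₑ⁻¹ * C := by gcongr; exact hC w hwR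
    _ = C / ENNReal.ofReal ρ := by rw [← ofReal_norm, hw, div_eq_mul_inv, mul_comm]

theorem spectralRadius_le_div_mul_enorm_of_forall_mem_ball (hd : DifferentiableOn ℂ f (ball c R))
    (hf : f c = 0) (hC : ∀ w ∈ ball c R, spectralRadius ℂ (f w) ≤ C) (hz : z ∈ ball c R) :
    spectralRadius ℂ (f z) ≤ C / ENNReal.ofReal R * ‖z - c‖ₑ := by
  have hfz : f z = (z - c) • dslope f c z := by rw [sub_smul_dslope, hf, sub_zero]
  rw [hfz, spectralRadius_smul, mul_comm]
  gcongr
  exact spectralRadius_dslope_le_div_of_forall_mem_ball hd hf hC hz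

end SpectralRadius

section StructuredSingularValue

open Metric
open scoped ENNReal Matrix.Norms.L2Operator

theorem one_mem_spectrum_iff_det_one_sub_eq_zero {𝕜 ι : Type*} [Field 𝕜] [Fintype ι]
    [DecidableEq ι] {A : Matrix ι ι 𝕜} : 1 ∈ spectrum 𝕜 A ↔ (1 - A).det = 0 := by
  rw [spectrum.mem_iff, map_one, Matrix.isUnit_iff_isUnit_det, isUnit_iff_ne_zero, not_not]

variable {m n : ℕ} {E : Submodule ℂ (Matrix (Fin n) (Fin m) ℂ)}

theorem structuredSingularValue_le_iff_one_le_mul_enorm {A : Matrix (Fin m) (Fin n) ℂ}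
    {c : ℝ≥0∞} :
    structuredSingularValue E A ≤ c ↔ ∀ X ∈ E, (1 - A * X).det = 0 → 1 ≤ c * ‖X‖ₑ := by
  rw [structuredSingularValue, ENNReal.inv_le_iff_inv_le]
  simp only [le_iInf_iff, and_imp]
  refine forall₃_congr fun X _ hdet => ENNReal.inv_le_iff_le_mul (by simp) fun _ hX => ?_
  rw [enorm_eq_zero] at hX
  simp [hX] at hdet

theorem structuredSingularValue_le_iff_spectralRadius_le {A : Matrix (Fin m) (Fin n) ℂ}
    {c : ℝ≥0∞} :
    structuredSingularValue E A ≤ c ↔ ∀ X ∈ E, spectralRadius ℂ (A * X) ≤ c * ‖X‖ₑ := by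
  rw [structuredSingularValue_le_iff_one_le_mul_enorm]
  constructor
  · intro h X hX
    refine iSup₂_le fun z hz => ?_
    rcases eq_or_ne z 0 with rfl | hz0
    · simp
    obtain ⟨Y, hY, rfl⟩ : ∃ Y ∈ E, z • Y = X :=
      ⟨z⁻¹ • X, E.smul_mem _ hX, smul_inv_smul₀ hz0 X⟩
    have hone : 1 ∈ spectrum ℂ (A * Y) := by
      rw [← spectrum.smul_mem_smul_iff (r := Units.mk0 z hz0)]
      simpa [Units.smul_def] using hz
    calc ‖z‖ₑ = ‖z‖ₑ * 1 := (mul_one _).symm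
      _ ≤ ‖z‖ₑ * (c * ‖Y‖ₑ) := by
        gcongr
        exact h Y hY (one_mem_spectrum_iff_det_one_sub_eq_zero.1 hone)
      _ = c * ‖z • Y‖ₑ := by rw [enorm_smul, mul_left_comm]
  · intro h X hX hdet
    have hone : 1 ∈ spectrum ℂ (A * X) := one_mem_spectrum_iff_det_one_sub_eq_zero.2 hdet
    calc 1 = ‖(1 : ℂ)‖ₑ := enorm_one.symm
      _ ≤ spectralRadius ℂ (A * X) := le_iSup₂ (f := fun (k : ℂ) _ => ‖k‖ₑ) 1 hone
      _ ≤ c * ‖X‖ₑ := h X hX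

theorem structuredSingularValue_smul_le (A : Matrix (Fin m) (Fin n) ℂ) (k : ℂ) :
    structuredSingularValue E (k • A) ≤ ‖k‖ₑ * structuredSingularValue E A := by
  refine structuredSingularValue_le_iff_spectralRadius_le.2 fun X hX => ?_
  rw [Matrix.smul_mul, spectralRadius_smul, mul_assoc]
  gcongr
  exact structuredSingularValue_le_iff_spectralRadius_le.1 le_rfl X hX

theorem structuredSingularValue_le_div_mul_enorm_of_forall_mem_ball
    {F : ℂ → Matrix (Fin m) (Fin n) ℂ} {c z : ℂ} {R : ℝ} {C : ℝ≥0∞}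
    (hd : ∀ i j, DifferentiableOn ℂ (fun w => F w i j) (ball c R)) (hF : F c = 0)
    (hC : ∀ w ∈ ball c R, structuredSingularValue E (F w) ≤ C) (hz : z ∈ ball c R) :
    structuredSingularValue E (F z) ≤ C / ENNReal.ofReal R * ‖z - c‖ₑ := by
  refine structuredSingularValue_le_iff_spectralRadius_le.2 fun X hX => ?_
  have hdX : DifferentiableOn ℂ (fun w => F w * X) (ball c R) :=
    differentiableOn_pi.2 fun i => differentiableOn_pi.2 fun j => by
      simp only [Matrix.mul_apply]
      fun_prop
  have hcX : F c * X = 0 := by rw [hF, Matrix.zero_mul]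
  have hCX : ∀ w ∈ ball c R, spectralRadius ℂ (F w * X) ≤ C * ‖X‖ₑ := fun w hw =>
    structuredSingularValue_le_iff_spectralRadius_le.1 (hC w hw) X hX
  refine (spectralRadius_le_div_mul_enorm_of_forall_mem_ball hdX hcX hCX hz).trans_eq ?_
  rw [ENNReal.mul_div_right_comm, mul_right_comm]

end StructuredSingularValue

theorem isNevanlinna_of_forall_norm_le {f : ℂ → ℂ} {M : ℝ}
    (hd : DifferentiableOn ℂ f (Metric.ball 0 1)) (hM : ∀ z ∈ Metric.ball 0 1, ‖f z‖ ≤ M) :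
    IsNevanlinna f := by
  refine ⟨hd, Real.posLog M, fun r hr hr1 => ?_⟩
  have hsub : Metric.sphere (0 : ℂ) |r| ⊆ Metric.ball 0 1 := by
    rw [abs_of_pos hr]
    exact Metric.sphere_subset_ball hr1
  have hcont : ContinuousOn (fun z => Real.posLog ‖f z‖) (Metric.sphere 0 |r|) :=
    Real.continuous_posLog.comp_continuousOn (hd.continuousOn.mono hsub).norm
  exact Real.circleAverage_mono_on_of_le_circle hcont.circleIntegrable'
    fun z hz => Real.posLog_le_posLog (norm_nonneg _) (hM z (hsub hz))

theorem isMatrixNevanlinna_smul_const {m n : ℕ} (A : Matrix (Fin m) (Fin n) ℂ) :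
    IsMatrixNevanlinna fun z => z • A := by
  intro i j
  refine isNevanlinna_of_forall_norm_le (M := ‖A i j‖) ?_ fun z hz => ?_
  · exact differentiableOn_id.mul_const (A i j)
  · exact (norm_mul z (A i j)).trans_le <|
      mul_le_of_le_one_left (norm_nonneg _) (mem_ball_zero_iff.1 hz).le

theorem mainTheorem12 {m n : ℕ} (E : Submodule ℂ (Matrix (Fin n) (Fin m) ℂ))
    (lam₀ : ℂ) (hlam₀ : lam₀ ∈ Metric.ball (0 : ℂ) 1) (hne : lam₀ ≠ 0)
    (W : Matrix (Fin m) (Fin n) ℂ) :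
    (∃ F : ℂ → Matrix (Fin m) (Fin n) ℂ, IsMatrixNevanlinna F ∧ F 0 = 0 ∧ F lam₀ = W ∧
        ∀ z ∈ Metric.ball (0 : ℂ) 1, structuredSingularValue E (F z) < 1) ↔
      structuredSingularValue E W ≤ ‖lam₀‖ₑ := by
  constructor
  · rintro ⟨F, hF, hF0, rfl, hμ⟩
    simpa using structuredSingularValue_le_div_mul_enorm_of_forall_mem_ball
      (fun i j => (hF i j).1) hF0 (fun z hz => (hμ z hz).le) hlam₀
  · intro hW
    have hscale : structuredSingularValue E (lam₀⁻¹ • W) ≤ 1 :=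
      calc structuredSingularValue E (lam₀⁻¹ • W)
          ≤ ‖lam₀⁻¹‖ₑ * ‖lam₀‖ₑ := (structuredSingularValue_smul_le W _).trans (by gcongr)
        _ = 1 := by rw [← enorm_mul, inv_mul_cancel₀ hne, enorm_one]
    refine ⟨fun z => z • lam₀⁻¹ • W, isMatrixNevanlinna_smul_const _, by simp, by simp [hne],
      fun z hz => ?_⟩
    calc structuredSingularValue E (z • lam₀⁻¹ • W)
        ≤ ‖z‖ₑ * 1 := (structuredSingularValue_smul_le _ z).trans (by gcongr)
      _ < 1 := by
        rw [mul_one, ← ofReal_norm, ENNReal.ofReal_lt_one]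
        exact mem_ball_zero_iff.1 hz
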